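/- Let $\mathbf{Pos}$ be the category of partially ordered sets and monotone maps, let $\Delta$ be its full subcategory of finite non-empty totally ordered sets (the simplex category), and let $i : \Delta \hookrightarrow \mathbf{Pos}$ be the inclusion. Call a category cocomplete if it has all small colimits, and call a functor cocontinuous if it preserves all small colimits that exist in its domain. Then $(\mathbf{Pos}, i)$ is the free conservative cocompletion of $\Delta$, that is: 1. $\mathbf{Pos}$ is cocomplete; 2. $i$ is fully faithful and cocontinuous; 3. for every cocomplete category $\mathcal D$ and every cocontinuous functor $F : \Delta \to \mathcal D$ there is a cocontinuous functor $\widetilde F : \mathbf{Pos} \to \mathcal D$ together with a natural isomorphism $\widetilde F \circ i \cong F$, and it is essentially unique: if $G, G' : \mathbf{Pos} \to \mathcal D$ are cocontinuous and $\alpha : G \circ i \cong F$, $\alpha' : G' \circ i \cong F$ are natural isomorphisms, then there is exactly one natural isomorphism $\beta : G \cong G'$ with $\alpha' \circ (\beta i) = \alpha$. -/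

import Mathlib

open CategoryTheory CategoryTheory.Limits

universe u v w v₁ u₁ v₂ u₂

/-- The functor `G` is cocontinuous: it preserves every (`u`-)small colimit that exists in its
domain (the domain need not have all colimits). -/
abbrev Cocontinuous {C : Type u₁} [Category.{v₁} C] {D : Type u₂} [Category.{v₂} D]
    (G : C ⥤ D) : Prop :=
  PreservesColimitsOfSize.{u, u} G

/-- The category `D` is cocomplete: it has all (`u`-)small colimits. -/
abbrev Cocomplete (D : Type u₁) [Category.{v₁} D] : Prop :=
  HasColimitsOfSize.{u, u} D

/-- `I : C ⥤ E` exhibits `E` as the free conservative cocompletion of `C`. Here `u` is the universe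
of small sets, and `w`, `v` are the universes of the objects and of the morphisms of the cocomplete
categories `D` against which the universal property is tested. -/
structure IsFreeConservativeCocompletion {C : Type u₁} [Category.{v₁} C]
    {E : Type u₂} [Category.{v₂} E] (I : C ⥤ E) : Prop where
  cocomplete : Cocomplete.{u} E
  full : I.Full
  faithful : I.Faithful
  cocontinuous : Cocontinuous.{u} I
  /-- Every cocontinuous functor to a cocomplete category has a cocontinuous extension. -/
  exists_extension : ∀ (D : Type w) [Category.{v} D], Cocomplete.{u} D →
    ∀ F : C ⥤ D, Cocontinuous.{u} F →
      ∃ G : E ⥤ D, Cocontinuous.{u} G ∧ Nonempty (I ⋙ G ≅ F)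
  /-- Any two cocontinuous extensions are isomorphic, by exactly one isomorphism that is
  compatible with the identifications of their restrictions with `F`. -/
  unique_extension : ∀ (D : Type w) [Category.{v} D], Cocomplete.{u} D →
    ∀ F : C ⥤ D, Cocontinuous.{u} F →
      ∀ G G' : E ⥤ D, Cocontinuous.{u} G → Cocontinuous.{u} G' →
        ∀ (α : I ⋙ G ≅ F) (α' : I ⋙ G' ≅ F),
          ∃! β : G ≅ G', Functor.isoWhiskerLeft I β ≪≫ α' = α

/-- The property of a poset of being finite, non-empty and totally ordered. -/
def isFiniteNonemptyTotal : ObjectProperty PartOrd.{u} :=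
  fun P => Finite P ∧ Nonempty P ∧ ∀ x y : P, x ≤ y ∨ y ≤ x

/-- The simplex category: the full subcategory of the category of posets and monotone maps on the
finite non-empty totally ordered sets. -/
abbrev Simplex : Type (u + 1) := isFiniteNonemptyTotal.{u}.FullSubcategory

/-- The inclusion of the simplex category into the category of posets. -/
abbrev simplexInclusion : Simplex.{u} ⥤ PartOrd.{u} := isFiniteNonemptyTotal.{u}.ι

/-! A poset is the colimit of its points and its comparable pairs, a diagram of copies of `point`
and `edge`. Hence a transformation out of a cocontinuous functor on posets is determined by its
restriction to simplices, and any such restriction is allowed (`existsUnique_whiskerLeft_eq`).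

For existence, let `F` be cocontinuous. Three colimits in the simplex category present `edge`,
`point` and `triangle` by two parallel, antiparallel and composable edges. That `F` preserves them
means that a morphism from `F.obj edge` to `d` is determined by its endpoints, and that the relation
so defined on `F.obj point ⟶ d` is antisymmetric and transitive: the points of `d` form a poset
(`pointOrder`). If `X P` is the colimit in `D` of the points and edges of `P`, then morphisms `X P ⟶
d` are the monotone maps from `P` to this poset. So `X` behaves as a left adjoint and is
cocontinuous; since hom-sets of `D` may lie in another universe, this is checked directly on
colimits.

The inclusion is cocontinuous because maps to `edge` are monotone predicates, and these detect the
order. -/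

/-! ### Colimits of posets -/

namespace PartOrd

variable {J : Type u} [SmallCategory J]

/-- The compatible families of monotone predicates on the posets of a diagram. -/
abbrev PredFamily (K : J ⥤ PartOrd.{u}) : Type u :=
  {f : ∀ j, K.obj j → Prop // (∀ j, Monotone (f j)) ∧
    ∀ (i j : J) (φ : i ⟶ j) (x : K.obj i), f j (K.map φ x) = f i x}

/-- The joint evaluation of all compatible families of monotone predicates. -/
def evalFamily (K : J ⥤ PartOrd.{u}) (a : Σ j, K.obj j) : PredFamily K → Prop :=
  fun f => f.1 a.1 a.2

/-- The family of predicates `¬ (· ≤ b)` pulled back along a cocone of monotone maps to a poset. -/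
def notLEFamily {K : J ⥤ PartOrd.{u}} {Q : Type v} [PartialOrder Q] (t : ∀ j, K.obj j →o Q)
    (ht : ∀ (i j : J) (φ : i ⟶ j) (x : K.obj i), t j (K.map φ x) = t i x) (b : Q) :
    PredFamily K :=
  ⟨fun j x => ¬ t j x ≤ b, fun j _ _ h hx hy => hx (((t j).monotone h).trans hy),
    fun i j φ x => by simp only [ht i j φ x]⟩

/-- Otherwise the predicate "not below the image of `b`" would hold at `a` but not at `b`. -/
lemma le_of_evalFamily_le {K : J ⥤ PartOrd.{u}} {Q : Type v} [PartialOrder Q]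
    (t : ∀ j, K.obj j →o Q)
    (ht : ∀ (i j : J) (φ : i ⟶ j) (x : K.obj i), t j (K.map φ x) = t i x)
    {a b : Σ j, K.obj j} (h : evalFamily K a ≤ evalFamily K b) : t a.1 a.2 ≤ t b.1 b.2 := by
  by_contra hab
  exact h (notLEFamily t ht (t b.1 b.2)) hab le_rfl

lemma cocone_w_apply {K : J ⥤ PartOrd.{u}} (s : Cocone K) {i j : J} (φ : i ⟶ j) (x : K.obj i) :
    (s.ι.app j).hom (K.map φ x) = (s.ι.app i).hom x := by
  rw [← s.w φ]; rfl

lemma cocone_le {K : J ⥤ PartOrd.{u}} (s : Cocone K) {a b : Σ j, K.obj j}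
    (h : evalFamily K a ≤ evalFamily K b) : (s.ι.app a.1).hom a.2 ≤ (s.ι.app b.1).hom b.2 :=
  le_of_evalFamily_le (Q := s.pt) (fun j => (s.ι.app j).hom)
    (fun _ _ φ x => cocone_w_apply s φ x) h

/-- The colimit cocone of a diagram of posets: the poset of joint evaluations. -/
def rangeCocone (K : J ⥤ PartOrd.{u}) : Cocone K where
  pt := PartOrd.of (Set.range (evalFamily K))
  ι :=
    { app := fun j => PartOrd.ofHom
        ⟨fun x => ⟨evalFamily K ⟨j, x⟩, Set.mem_range_self _⟩, fun _ _ h f => f.2.1 j h⟩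
      naturality := fun i j φ => by
        ext x
        exact Subtype.ext (funext fun f => f.2.2 i j φ x) }

/-- The cocone of joint evaluations is a colimit. -/
noncomputable def rangeCoconeIsColimit (K : J ⥤ PartOrd.{u}) : IsColimit (rangeCocone K) where
  desc s := PartOrd.ofHom
    ⟨fun z => (s.ι.app z.2.choose.1).hom z.2.choose.2, fun z z' h =>
      cocone_le s ((z.2.choose_spec.le.trans (Subtype.coe_le_coe.2 h)).trans z'.2.choose_spec.ge)⟩
  fac s j := by
    ext x
    -- By proof irrelevance, `h.choose` is the representative that `desc` picks.
    have h : ∃ a, evalFamily K a = evalFamily K ⟨j, x⟩ := ⟨_, rfl⟩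
    have h' : (s.ι.app h.choose.1).hom h.choose.2 = (s.ι.app j).hom x :=
      le_antisymm (cocone_le s (b := ⟨j, x⟩) h.choose_spec.le)
        (cocone_le s (a := ⟨j, x⟩) h.choose_spec.ge)
    exact h'
  uniq s m hm := by
    ext z
    conv_lhs => rw [show z = ⟨_, z.2.choose, rfl⟩ from Subtype.ext z.2.choose_spec.symm]
    exact congr($(hm z.2.choose.1).hom z.2.choose.2)

theorem cocomplete : Cocomplete.{u} PartOrd.{u} where
  has_colimits_of_shape _ _ := ⟨fun K => ⟨⟨⟨_, rangeCoconeIsColimit K⟩⟩⟩⟩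

/-- A colimit of small posets is also a colimit with respect to posets in other universes. -/
lemma hom_ext_of_isColimit {K : J ⥤ PartOrd.{u}} {c : Cocone K} (hc : IsColimit c) {Q : Type v}
    [PartialOrder Q] {f g : c.pt →o Q}
    (h : ∀ j (x : K.obj j), f ((c.ι.app j).hom x) = g ((c.ι.app j).hom x)) : f = g := by
  -- Only the images matter; they are small, so `Q` can be replaced by a poset in `Type u`.
  let S : Set Q := Set.range f ∪ Set.range g
  have : Small.{u} S := inferInstance
  let f₀ : c.pt →o S := ⟨fun x => ⟨f x, Or.inl ⟨x, rfl⟩⟩, fun _ _ h => f.monotone h⟩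
  let g₀ : c.pt →o S := ⟨fun x => ⟨g x, Or.inr ⟨x, rfl⟩⟩, fun _ _ h => g.monotone h⟩
  let e : S →o Shrink.{u} S := orderIsoShrink S
  have hfg : PartOrd.ofHom (e.comp f₀) = PartOrd.ofHom (e.comp g₀) := hc.hom_ext fun j => by
    refine PartOrd.ext fun x => ?_
    have hx : f₀ ((c.ι.app j).hom x) = g₀ ((c.ι.app j).hom x) := Subtype.ext (h j x)
    exact congrArg e hx
  ext x
  exact congrArg Subtype.val ((orderIsoShrink S).injective congr($(hfg).hom x))

lemma exists_desc_of_isColimit {K : J ⥤ PartOrd.{u}} {c : Cocone K} (hc : IsColimit c)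
    {Q : Type v} [PartialOrder Q] (t : ∀ j, K.obj j →o Q)
    (ht : ∀ (i j : J) (φ : i ⟶ j) (x : K.obj i), t j (K.map φ x) = t i x) :
    ∃ f : c.pt →o Q, ∀ j (x : K.obj j), f ((c.ι.app j).hom x) = t j x := by
  let S : Set Q := Set.range fun a : Σ j, K.obj j => t a.1 a.2
  have : Small.{u} S := inferInstance
  let s : Cocone K :=
    { pt := PartOrd.of (Shrink.{u} S)
      ι :=
        { app := fun j => PartOrd.ofHom ((orderIsoShrink S : S →o Shrink.{u} S).comp
            ⟨fun x => ⟨t j x, ⟨j, x⟩, rfl⟩, fun _ _ h => (t j).monotone h⟩)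
          naturality := fun i j φ => by
            ext x
            exact congrArg (orderIsoShrink S) (Subtype.ext (ht i j φ x)) } }
  refine ⟨⟨fun z => ((orderIsoShrink S).symm ((hc.desc s).hom z)).1, fun z z' h =>
    (orderIsoShrink S).symm.monotone ((hc.desc s).hom.monotone h)⟩, fun j x => ?_⟩
  have h := congr($(hc.fac s j).hom x)
  change (((orderIsoShrink S).symm ((hc.desc s).hom ((c.ι.app j).hom x))).1 : Q) = t j x
  have h' : (hc.desc s).hom ((c.ι.app j).hom x) = orderIsoShrink S ⟨t j x, ⟨j, x⟩, rfl⟩ := h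
  rw [h', OrderIso.symm_apply_apply]

end PartOrd

/-! ### The inclusion of the simplex category preserves colimits -/

namespace Simplex

/-- The simplex with two vertices. -/
def edge : Simplex.{u} where
  obj := PartOrd.of (ULift.{u} Bool)
  property := ⟨inferInstanceAs (Finite (ULift.{u} Bool)), ⟨⟨true⟩⟩,
    fun x y => le_total x.down y.down⟩

/-- The simplex with one vertex. -/
def point : Simplex.{u} where
  obj := PartOrd.of PUnit.{u + 1}
  property := ⟨inferInstanceAs (Finite PUnit), ⟨⟨⟩⟩, fun _ _ => Or.inl le_rfl⟩

/-- The inclusion of a vertex of the edge. -/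
def endpoint (b : Bool) : point.{u} ⟶ edge.{u} :=
  ObjectProperty.homMk (PartOrd.ofHom (OrderHom.const _ ⟨b⟩))

/-- A non-empty subset of a simplex, as a simplex. -/
def ofSubset (S : Simplex.{u}) (T : Set S.obj) (hT : T.Nonempty) : Simplex.{u} where
  obj := PartOrd.of T
  property := ⟨have := S.property.1; inferInstanceAs (Finite T), hT.to_subtype,
    fun x y => S.property.2.2 x.1 y.1⟩

open scoped Classical in
/-- The classifying map of a monotone predicate. -/
noncomputable def classify (S : Simplex.{u}) (p : S.obj → Prop) (hp : Monotone p) : S ⟶ edge :=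
  ObjectProperty.homMk (PartOrd.ofHom ⟨fun x => ⟨decide (p x)⟩, fun _ _ h => by
    simpa [Bool.le_iff_imp] using! hp h⟩)

lemma classify_apply (S : Simplex.{u}) (p : S.obj → Prop) (hp : Monotone p) (x : S.obj) :
    ((classify S p hp).hom.hom x : ULift Bool).down = true ↔ p x := by
  classical exact decide_eq_true_iff

section

variable {J : Type u} [SmallCategory J] {K : J ⥤ Simplex.{u}} {c : Cocone K}

/-- The cocone factors through its joint image `T`, itself a simplex, so the identity of the colimit
factors through `T` too. -/
lemma exists_of_isColimit (hc : IsColimit c) (z : c.pt.obj) :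
    ∃ j, ∃ x : (K.obj j).obj, (c.ι.app j).hom.hom x = z := by
  let T : Set c.pt.obj := {z | ∃ j, ∃ x : (K.obj j).obj, (c.ι.app j).hom.hom x = z}
  -- Were `T` empty, so would be `J`, and the vertex would be initial; but it has two distinct maps
  -- to `edge`.
  have hT : T.Nonempty := by
    by_contra hT
    have hJ : IsEmpty J := ⟨fun j => by
      obtain ⟨x⟩ := (K.obj j).property.2.1
      exact hT ⟨_, j, x, rfl⟩⟩
    have h : classify c.pt (fun _ => True) (fun _ _ _ => le_rfl) =
        classify c.pt (fun _ => False) (fun _ _ _ => le_rfl) := hc.hom_ext fun j => hJ.elim j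
    have h₁ := (classify_apply c.pt (fun _ => True) (fun _ _ _ => le_rfl) z).2 trivial
    rw [h] at h₁
    exact (classify_apply c.pt (fun _ => False) (fun _ _ _ => le_rfl) z).1 h₁
  let s : Cocone K :=
    { pt := ofSubset c.pt T hT
      ι :=
        { app := fun j => ObjectProperty.homMk (PartOrd.ofHom
            ⟨fun x => ⟨(c.ι.app j).hom.hom x, j, x, rfl⟩,
              fun _ _ h => (c.ι.app j).hom.hom.monotone h⟩)
          naturality := fun i j φ => by
            ext x
            exact Subtype.ext congr($(c.ι.naturality φ).hom.hom x) } }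
  let r : s.pt ⟶ c.pt := ObjectProperty.homMk (PartOrd.ofHom ⟨Subtype.val, fun _ _ h => h⟩)
  have h : hc.desc s ≫ r = 𝟙 _ := hc.hom_ext fun j => by
    rw [← Category.assoc, hc.fac, Category.comp_id]; rfl
  let y : T := (hc.desc s).hom.hom z
  have hz : y.1 = z := congr($(h).hom.hom z)
  exact hz ▸ y.2

/-- By joint surjectivity a descent is forced on points; `key` makes it well defined and monotone.
-/
theorem cocontinuous_inclusion : Cocontinuous.{u} simplexInclusion.{u} where
  preservesColimitsOfShape := ⟨fun {K} => ⟨fun {c} hc => ⟨by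
    have key : ∀ (s : Cocone (K ⋙ simplexInclusion)) (i j) (x : (K.obj i).obj) (y : (K.obj j).obj),
        (c.ι.app i).hom.hom x ≤ (c.ι.app j).hom.hom y →
          (s.ι.app i).hom x ≤ (s.ι.app j).hom y := by
      intro s i j x y hxy
      -- These predicates form a cocone to `edge`, so they descend to the colimit, where `x ≤ y`
      -- transports `p` from `x` to `y`.
      let p := fun k (z : (K.obj k).obj) => ¬ (s.ι.app k).hom z ≤ (s.ι.app j).hom y
      have hp : ∀ k, Monotone (p k) := fun k _ _ h hx hy =>
        hx (((s.ι.app k).hom.monotone h).trans hy)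
      let t : Cocone K :=
        { pt := edge
          ι :=
            { app := fun k => classify (K.obj k) (p k) (hp k)
              naturality := fun k l φ => by
                ext z
                refine ULift.ext _ _ (Bool.eq_iff_iff.2 ?_)
                have h : (s.ι.app l).hom ((K.map φ).hom.hom z) = (s.ι.app k).hom z :=
                  PartOrd.cocone_w_apply s φ z
                refine (classify_apply _ _ (hp l) _).trans
                  (Iff.trans ?_ (classify_apply _ _ (hp k) z).symm)
                simp only [p]
                rw [← h]
                rfl } }
      have hfac : ∀ k (z : (K.obj k).obj),
          ((hc.desc t).hom.hom ((c.ι.app k).hom.hom z) : ULift Bool).down = true ↔ p k z := by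
        intro k z
        rw [← classify_apply _ _ (hp k) z]
        exact iff_of_eq congr(($(hc.fac t k).hom.hom z : ULift Bool).down = true)
      by_contra hxy'
      have h₁ := (hfac i x).2 hxy'
      have h₂ : ((hc.desc t).hom.hom ((c.ι.app i).hom.hom x) : ULift Bool).down ≤
        ((hc.desc t).hom.hom ((c.ι.app j).hom.hom y) : ULift Bool).down :=
          (hc.desc t).hom.hom.monotone hxy
      exact (hfac j y).1 (Bool.le_iff_imp.1 h₂ h₁) le_rfl
    choose k a ha using exists_of_isColimit hc
    exact
      { desc := fun s => PartOrd.ofHom ⟨fun z => (s.ι.app (k z)).hom (a z), fun z z' h =>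
          key s _ _ _ _ (by rw [ha, ha]; exact h)⟩
        fac := fun s j => by
          ext x
          exact le_antisymm (key s _ _ _ _ (ha _).le) (key s _ _ _ _ (ha _).ge)
        uniq := fun s m hm => by
          ext z
          conv_lhs => rw [← ha z]
          exact congr($(hm (k z)).hom (a z)) }⟩⟩⟩

end

end Simplex

/-! ### Diagrams of points and edges -/

/-- A directed graph; `ends e false` is the source and `ends e true` the target of `e`. -/
structure PosetGraph where
  V : Type u
  E : Type u
  ends : E → Bool → V

namespace PosetGraph

open Simplex

/-- The shape of the diagram of the points and the edges of a graph. -/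
def shape (Γ : PosetGraph.{u}) : MultispanShape.{u, u} where
  L := Γ.E × Bool
  R := Γ.V ⊕ Γ.E
  fst a := Sum.inl (Γ.ends a.1 a.2)
  snd a := Sum.inr a.1

/-- The incidences between the points and the edges of a graph. -/
def index (Γ : PosetGraph.{u}) : MultispanIndex Γ.shape Simplex.{u} where
  left _ := point
  right := Sum.elim (fun _ => point) (fun _ => edge)
  fst _ := 𝟙 point
  snd a := endpoint a.2

/-- The diagram of the points and the edges of a graph. -/
abbrev diagram (Γ : PosetGraph.{u}) : WalkingMultispan Γ.shape ⥤ Simplex.{u} := Γ.index.multispan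

variable {D : Type w} [Category.{v} D]

/-- A realization of a graph in the object `d`, where `H` specifies the point and the edge. -/
structure Realization (Γ : PosetGraph.{u}) (H : Simplex.{u} ⥤ D) (d : D) where
  vert : Γ.V → (H.obj point ⟶ d)
  edge : Γ.E → (H.obj Simplex.edge ⟶ d)
  comm : ∀ e b, H.map (endpoint b) ≫ edge e = vert (Γ.ends e b)

namespace Realization

variable {Γ : PosetGraph.{u}} {H : Simplex.{u} ⥤ D} {d : D}

/-- A realization is universal if every other one factors uniquely through it. -/
def IsUniversal (t : Γ.Realization H d) : Prop :=
  ∀ (c : D) (s : Γ.Realization H c), ∃! g : d ⟶ c,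
    (∀ x, t.vert x ≫ g = s.vert x) ∧ ∀ e, t.edge e ≫ g = s.edge e

/-- The cocone associated with a realization. -/
def toCocone (t : Γ.Realization H d) : Cocone (Γ.diagram ⋙ H) where
  pt := d
  ι :=
    { app := fun
        | .left a => t.vert (Γ.ends a.1 a.2)
        | .right (.inl x) => t.vert x
        | .right (.inr e) => t.edge e
      naturality := by
        rintro _ _ (_ | a | a)
        · exact (congrArg (· ≫ _) (CategoryTheory.Functor.map_id _ _)).trans
            ((Category.id_comp _).trans (Category.comp_id _).symm)
        · exact (congrArg (· ≫ _) (H.map_id _)).trans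
            ((Category.id_comp _).trans (Category.comp_id _).symm)
        · exact (t.comm a.1 a.2).trans (Category.comp_id _).symm }

/-- The realization associated with a cocone. -/
def ofCocone (c : Cocone (Γ.diagram ⋙ H)) : Γ.Realization H c.pt where
  vert x := c.ι.app (.right (.inl x))
  edge e := c.ι.app (.right (.inr e))
  comm e b := by
    have h₁ := c.w (WalkingMultispan.Hom.fst (J := Γ.shape) (e, b))
    have h₂ := c.w (WalkingMultispan.Hom.snd (J := Γ.shape) (e, b))
    refine h₂.trans (h₁.symm.trans ?_)
    exact (congrArg (· ≫ _) (H.map_id _)).trans (Category.id_comp _)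

lemma cocone_app_left (c : Cocone (Γ.diagram ⋙ H)) (a : Γ.shape.L) :
    c.ι.app (.left a) = c.ι.app (.right (.inl (Γ.ends a.1 a.2))) := by
  have h := c.w (WalkingMultispan.Hom.fst (J := Γ.shape) a)
  exact h.symm.trans ((congrArg (· ≫ _) (H.map_id _)).trans (Category.id_comp _))

lemma isUniversal_ofCocone {c : Cocone (Γ.diagram ⋙ H)} (hc : IsColimit c) :
    (ofCocone c).IsUniversal := by
  intro d' t'
  refine ⟨hc.desc t'.toCocone, ⟨fun x => hc.fac t'.toCocone (.right (.inl x)),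
    fun e => hc.fac t'.toCocone (.right (.inr e))⟩, fun g hg => ?_⟩
  refine hc.uniq t'.toCocone g ?_
  rintro (a | x | e)
  · rw [cocone_app_left]
    exact hg.1 _
  · exact hg.1 x
  · exact hg.2 e

lemma IsUniversal.nonempty_isColimit {t : Γ.Realization H d} (ht : t.IsUniversal) :
    Nonempty (IsColimit t.toCocone) := by
  choose f hf hf' using fun s : Cocone (Γ.diagram ⋙ H) => ht _ (ofCocone s)
  refine ⟨{ desc := f, fac := ?_, uniq := ?_ }⟩
  · rintro s (a | x | e)
    · rw [cocone_app_left s]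
      exact (hf s).1 _
    · exact (hf s).1 x
    · exact (hf s).2 e
  · intro s m hm
    exact hf' s m ⟨fun x => hm (.right (.inl x)), fun e => hm (.right (.inr e))⟩

variable {D₂ : Type u₂} [Category.{v₂} D₂]

/-- The image of a realization under a functor. -/
@[simps]
def map (t : Γ.Realization H d) (G : D ⥤ D₂) : Γ.Realization (H ⋙ G) (G.obj d) where
  vert x := G.map (t.vert x)
  edge e := G.map (t.edge e)
  comm e b := by rw [← t.comm, G.map_comp]; rfl

lemma IsUniversal.map {t : Γ.Realization H d} (ht : t.IsUniversal) (G : D ⥤ D₂)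
    (hG : Cocontinuous.{u} G) : (t.map G).IsUniversal := by
  obtain ⟨hc⟩ := ht.nonempty_isColimit
  exact isUniversal_ofCocone (Γ := Γ) (H := H ⋙ G) (isColimitOfPreserves G hc)

lemma isUniversal_of_map {t : Γ.Realization H d} (G : D ⥤ D₂) [G.Full] [G.Faithful]
    (ht : (t.map G).IsUniversal) : t.IsUniversal := by
  intro d' t'
  obtain ⟨g, hg, hg'⟩ := ht _ (t'.map G)
  refine ⟨G.preimage g, ⟨fun x => G.map_injective ?_, fun e => G.map_injective ?_⟩,
    fun m hm => G.map_injective ?_⟩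
  · rw [G.map_comp, G.map_preimage]; exact hg.1 x
  · rw [G.map_comp, G.map_preimage]; exact hg.2 e
  · rw [G.map_preimage]
    refine hg' _ ⟨fun x => ?_, fun e => ?_⟩
    · rw [map_vert, map_vert, ← G.map_comp, hm.1]
    · rw [map_edge, map_edge, ← G.map_comp, hm.2]

lemma IsUniversal.hom_ext {t : Γ.Realization H d} (ht : t.IsUniversal) {d' : D} {g g' : d ⟶ d'}
    (h₁ : ∀ x, t.vert x ≫ g = t.vert x ≫ g') (h₂ : ∀ e, t.edge e ≫ g = t.edge e ≫ g') :
    g = g' :=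
  (ht d' ⟨fun x => t.vert x ≫ g', fun e => t.edge e ≫ g',
    fun e b => by rw [← Category.assoc, t.comm]⟩).unique ⟨h₁, h₂⟩ ⟨fun _ => rfl, fun _ => rfl⟩

end Realization

end PosetGraph

/-! ### Posets as colimits of points and edges -/

namespace Simplex

/-- A point of a poset as a morphism. -/
def pointTo (P : PartOrd.{u}) (x : P) : point.{u}.obj ⟶ P :=
  PartOrd.ofHom (OrderHom.const _ x)

/-- A pair of comparable points of a poset as a morphism. -/
def edgeTo (P : PartOrd.{u}) (f : Bool → P) (h : f false ≤ f true) : edge.{u}.obj ⟶ P :=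
  PartOrd.ofHom ⟨fun b => f b.down, by
    rintro ⟨_ | _⟩ ⟨_ | _⟩ hb
    exacts [le_rfl, h, absurd (show true ≤ false from hb) (by decide), le_rfl]⟩

lemma edge_monotone {P : PartOrd.{u}} (f : edge.{u}.obj ⟶ P) :
    f.hom (⟨false⟩ : ULift Bool) ≤ f.hom (⟨true⟩ : ULift Bool) :=
  f.hom.monotone (show (⟨false⟩ : ULift.{u} Bool) ≤ ⟨true⟩ from Bool.false_le _)

end Simplex

namespace PosetGraph

open Simplex

/-- The map `q` exhibits `P` as the poset generated by the graph `Γ`. -/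
structure Presents (Γ : PosetGraph.{u}) (P : PartOrd.{u}) (q : Γ.V → P) : Prop where
  le : ∀ e, q (Γ.ends e false) ≤ q (Γ.ends e true)
  surjective : Function.Surjective q
  lift : ∀ (Q : Type u) [PartialOrder Q] (f : Γ.V → Q),
    (∀ e, f (Γ.ends e false) ≤ f (Γ.ends e true)) → ∀ x y, q x ≤ q y → f x ≤ f y

variable {Γ : PosetGraph.{u}}

/-- The tautological realization of a graph in the poset that it presents. -/
def Presents.realization {P : PartOrd.{u}} {q : Γ.V → P} (h : Γ.Presents P q) :
    Γ.Realization simplexInclusion P where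
  vert x := pointTo P (q x)
  edge e := edgeTo P (fun b => q (Γ.ends e b)) (h.le e)
  comm _ _ := rfl

/-- A realization in a poset `Q` amounts to a vertex map that increases along edges, which descends
along `q`. -/
lemma Presents.isUniversal {P : PartOrd.{u}} {q : Γ.V → P} (h : Γ.Presents P q) :
    h.realization.IsUniversal := by
  intro Q t
  let f : Γ.V → Q := fun x => (t.vert x).hom (⟨⟩ : PUnit)
  have hf : ∀ e b, (t.edge e).hom (⟨b⟩ : ULift Bool) = f (Γ.ends e b) := fun e b =>
    congr(($(t.comm e b)).hom (⟨⟩ : PUnit))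
  have hle : ∀ x y, q x ≤ q y → f x ≤ f y := h.lift Q f fun e => by
    rw [← hf, ← hf]
    exact edge_monotone _
  choose r hr using h.surjective
  have hfr : ∀ x, f (r (q x)) = f x := fun x => le_antisymm (hle _ _ (hr _).le) (hle _ _ (hr _).ge)
  refine ⟨PartOrd.ofHom ⟨fun z => f (r z), fun z z' hz => hle _ _ (by rwa [hr, hr])⟩,
    ⟨fun x => ?_, fun e => ?_⟩, fun g hg => ?_⟩
  · refine PartOrd.ext fun _ => ?_
    exact hfr x
  · refine PartOrd.ext fun b => ?_
    exact (hfr _).trans (hf e b.down).symm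
  · refine PartOrd.ext fun z => ?_
    have h₁ : g.hom (q (r z)) = f (r z) := congr(($(hg.1 (r z))).hom (⟨⟩ : PUnit))
    rw [hr] at h₁
    exact h₁

/-- The tautological realization of a graph in the simplex that it presents. -/
def Presents.simplexRealization {S : Simplex.{u}} {q : Γ.V → S.obj} (h : Γ.Presents S.obj q) :
    Γ.Realization (𝟭 Simplex) S where
  vert x := ObjectProperty.homMk (pointTo S.obj (q x))
  edge e := ObjectProperty.homMk (edgeTo S.obj (fun b => q (Γ.ends e b)) (h.le e))
  comm _ _ := rfl

variable {D : Type w} [Category.{v} D]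

/-- The realization of a graph in the image of the simplex that it presents. -/
def Presents.mapRealization {S : Simplex.{u}} {q : Γ.V → S.obj} (h : Γ.Presents S.obj q)
    (F : Simplex.{u} ⥤ D) : Γ.Realization F (F.obj S) where
  vert x := F.map (ObjectProperty.homMk (pointTo S.obj (q x)))
  edge e := F.map (ObjectProperty.homMk (edgeTo S.obj (fun b => q (Γ.ends e b)) (h.le e)))
  comm _ _ := by rw [← F.map_comp]; rfl

/-- The colimit in posets is reflected by the fully faithful inclusion and then preserved by `F`. -/
lemma Presents.isUniversal_mapRealization {S : Simplex.{u}} {q : Γ.V → S.obj}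
    (h : Γ.Presents S.obj q) (F : Simplex.{u} ⥤ D) (hF : Cocontinuous.{u} F) :
    (h.mapRealization F).IsUniversal := by
  have h₁ : h.simplexRealization.IsUniversal :=
    Realization.isUniversal_of_map simplexInclusion h.isUniversal
  exact h₁.map F hF

/-- The graph of all comparable pairs of a poset. -/
abbrev ofPoset (P : PartOrd.{u}) : PosetGraph.{u} where
  V := P
  E := {p : Bool → P // p false ≤ p true}
  ends e b := e.1 b

lemma presents_ofPoset (P : PartOrd.{u}) : (ofPoset P).Presents P id where
  le e := e.2
  surjective := Function.surjective_id
  lift _ _ _ hf x y hxy := hf ⟨fun b => cond b y x, hxy⟩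

/-- Two parallel edges. -/
def parallel : PosetGraph.{u} where
  V := ULift Bool
  E := ULift Bool
  ends _ b := ⟨b⟩

lemma presents_parallel : parallel.{u}.Presents edge.obj id where
  le _ := edge_monotone (𝟙 edge.{u}.obj)
  surjective := Function.surjective_id
  lift Q _ f hf := by
    rintro ⟨_ | _⟩ ⟨_ | _⟩ h
    · exact le_rfl
    · exact hf ⟨true⟩
    · exact absurd (show true ≤ false from h) (by decide)
    · exact le_rfl

/-- Two antiparallel edges. -/
@[simps]
def antiparallel : PosetGraph.{u} where
  V := ULift Bool
  E := ULift Bool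
  ends e b := ⟨xor e.down b⟩

lemma presents_antiparallel :
    antiparallel.{u}.Presents point.obj (fun _ => (⟨⟩ : PUnit)) where
  le _ := le_rfl
  surjective _ := ⟨⟨true⟩, rfl⟩
  lift Q _ f hf := by
    rintro ⟨_ | _⟩ ⟨_ | _⟩ -
    · exact le_rfl
    · exact hf ⟨false⟩
    · exact hf ⟨true⟩
    · exact le_rfl

/-- Two composable edges. -/
def composable : PosetGraph.{u} where
  V := ULift (Fin 3)
  E := ULift Bool
  ends e b := ⟨cond e.down (cond b 2 1) (cond b 1 0)⟩

end PosetGraph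

/-- The simplex with three vertices. -/
def Simplex.triangle : Simplex.{u} where
  obj := PartOrd.of (ULift.{u} (Fin 3))
  property := ⟨inferInstanceAs (Finite (ULift.{u} (Fin 3))), ⟨⟨0⟩⟩,
    fun x y => le_total x.down y.down⟩

namespace PosetGraph

open Simplex

lemma presents_composable : composable.{u}.Presents triangle.obj id where
  le := by
    rintro ⟨_ | _⟩
    · exact (by decide : (0 : Fin 3) ≤ 1)
    · exact (by decide : (1 : Fin 3) ≤ 2)
  surjective := Function.surjective_id
  lift Q _ f hf := by
    have h₀₁ : f ⟨0⟩ ≤ f ⟨1⟩ := hf ⟨false⟩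
    have h₁₂ : f ⟨1⟩ ≤ f ⟨2⟩ := hf ⟨true⟩
    rintro ⟨x⟩ ⟨y⟩ h
    replace h : x ≤ y := h
    fin_cases x <;> fin_cases y <;>
      first
        | exact le_rfl
        | exact h₀₁
        | exact h₁₂
        | exact h₀₁.trans h₁₂
        | exact absurd h (by decide)

end PosetGraph

/-! ### Uniqueness of cocontinuous extensions -/

section Uniqueness

open Simplex PosetGraph

variable {D : Type w} [Category.{v} D]

/-- Transformations out of a cocontinuous functor on posets are determined, and can be prescribed
arbitrarily, on the simplices. -/
theorem existsUnique_whiskerLeft_eq {G G' : PartOrd.{u} ⥤ D} (hG : Cocontinuous.{u} G)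
    (γ : simplexInclusion.{u} ⋙ G ⟶ simplexInclusion ⋙ G') :
    ∃! β : G ⟶ G', Functor.whiskerLeft simplexInclusion β = γ := by
  have hu : ∀ P, ((presents_ofPoset P).realization.map G).IsUniversal := fun P =>
    (presents_ofPoset P).isUniversal.map G hG
  have hγp : ∀ (S : Simplex.{u}) (x : S.obj), G.map (pointTo S.obj x) ≫ γ.app S =
      γ.app point ≫ G'.map (pointTo S.obj x) := fun S x =>
    γ.naturality (X := point) (ObjectProperty.homMk (pointTo S.obj x))
  have hγe : ∀ (S : Simplex.{u}) (e : (ofPoset S.obj).E),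
      G.map (edgeTo S.obj e.1 e.2) ≫ γ.app S =
        γ.app edge ≫ G'.map (edgeTo S.obj e.1 e.2) := fun S e =>
    γ.naturality (X := edge) (ObjectProperty.homMk (edgeTo S.obj e.1 e.2))
  -- Naturality against points and edges forces these values.
  let t (P : PartOrd.{u}) : (ofPoset P).Realization (simplexInclusion ⋙ G) (G'.obj P) :=
    { vert := fun x => γ.app point ≫ G'.map (pointTo P x)
      edge := fun e => γ.app edge ≫ G'.map (edgeTo P e.1 e.2)
      comm := fun e b => by
        rw [← Category.assoc, γ.naturality, Category.assoc, Functor.comp_map, ← G'.map_comp]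
        rfl }
  choose β hβ hβ' using fun P => hu P _ (t P)
  have hp : ∀ (P : PartOrd.{u}) (x : P),
    G.map (pointTo P x) ≫ β P = γ.app point ≫ G'.map (pointTo P x) := fun P => (hβ P).1
  have he : ∀ (P : PartOrd.{u}) (e : (ofPoset P).E), G.map (edgeTo P e.1 e.2) ≫ β P =
    γ.app edge ≫ G'.map (edgeTo P e.1 e.2) := fun P => (hβ P).2
  refine ⟨{ app := β, naturality := fun P Q φ => ?_ }, ?_, fun β₁ hβ₁ => ?_⟩
  · refine (hu P).hom_ext (fun x => ?_) (fun e => ?_)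
    · change G.map (pointTo P x) ≫ _ = G.map (pointTo P x) ≫ _
      rw [← Category.assoc, ← G.map_comp, ← Category.assoc, hp, Category.assoc, ← G'.map_comp]
      exact hp Q (φ.hom x)
    · change G.map (edgeTo P e.1 e.2) ≫ _ = G.map (edgeTo P e.1 e.2) ≫ _
      rw [← Category.assoc, ← G.map_comp, ← Category.assoc, he, Category.assoc, ← G'.map_comp]
      exact he Q ⟨fun b => φ.hom (e.1 b), φ.hom.monotone e.2⟩
  · ext S
    exact (hu S.obj).hom_ext (fun x => (hp S.obj x).trans (hγp S x).symm)
      (fun e => (he S.obj e).trans (hγe S e).symm)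
  · subst hβ₁
    ext P
    exact hβ' P _ ⟨fun x => β₁.naturality (pointTo P x),
      fun e => β₁.naturality (edgeTo P e.1 e.2)⟩

theorem existsUnique_iso {F : Simplex.{u} ⥤ D} {G G' : PartOrd.{u} ⥤ D}
    (hG : Cocontinuous.{u} G) (hG' : Cocontinuous.{u} G') (α : simplexInclusion.{u} ⋙ G ≅ F)
    (α' : simplexInclusion.{u} ⋙ G' ≅ F) :
    ∃! β : G ≅ G', Functor.isoWhiskerLeft simplexInclusion β ≪≫ α' = α := by
  obtain ⟨β, hβ, hβu⟩ := existsUnique_whiskerLeft_eq hG (α ≪≫ α'.symm).hom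
  obtain ⟨β', hβ', -⟩ := existsUnique_whiskerLeft_eq hG' (α' ≪≫ α.symm).hom
  have h₁ : β ≫ β' = 𝟙 G := (existsUnique_whiskerLeft_eq hG (𝟙 _)).unique
    (by simp only [Functor.whiskerLeft_comp, hβ, hβ']; simp) (by simp)
  have h₂ : β' ≫ β = 𝟙 G' := (existsUnique_whiskerLeft_eq hG' (𝟙 _)).unique
    (by simp only [Functor.whiskerLeft_comp, hβ, hβ']; simp) (by simp)
  refine ⟨⟨β, β', h₁, h₂⟩, ?_, fun β₁ hβ₁ => ?_⟩
  · refine Iso.ext ?_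
    change Functor.whiskerLeft _ β ≫ α'.hom = α.hom
    rw [hβ]
    simp
  · refine Iso.ext (hβu _ ?_)
    subst hβ₁
    simp

end Uniqueness

/-! ### Existence of cocontinuous extensions -/

namespace Simplex

open PosetGraph

variable {D : Type w} [Category.{v} D] {F : Simplex.{u} ⥤ D} {d : D}

/-- Put `g` and `g'` on two parallel edges: the colimit identifies these edges. -/
lemma edge_hom_ext (hF : Cocontinuous.{u} F) {g g' : F.obj edge ⟶ d}
    (h : ∀ b, F.map (endpoint b) ≫ g = F.map (endpoint b) ≫ g') : g = g' := by
  let t : parallel.Realization F d :=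
    { vert := fun x => F.map (endpoint x.down) ≫ g
      edge := fun e => cond e.down g g'
      comm := by
        rintro ⟨_ | _⟩ b
        · exact (h b).symm
        · rfl }
  obtain ⟨k, ⟨-, hk⟩, -⟩ := presents_parallel.isUniversal_mapRealization F hF d t
  exact (hk ⟨true⟩).symm.trans (hk ⟨false⟩)

/-- Put `g` and `g'` on two antiparallel edges: the colimit is a point, so the vertices coincide. -/
lemma edge_antisymm (hF : Cocontinuous.{u} F) {g g' : F.obj edge ⟶ d}
    (h : ∀ b, F.map (endpoint b) ≫ g = F.map (endpoint !b) ≫ g') :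
    F.map (endpoint false) ≫ g = F.map (endpoint true) ≫ g := by
  let t : antiparallel.Realization F d :=
    { vert := fun x => F.map (endpoint x.down) ≫ g
      edge := fun e => cond e.down g' g
      comm := by
        rintro ⟨_ | _⟩ b
        · simp
        · simpa using (h !b).symm }
  obtain ⟨k, ⟨hk, -⟩, -⟩ := presents_antiparallel.isUniversal_mapRealization F hF d t
  exact (hk ⟨false⟩).symm.trans (hk ⟨true⟩)

/-- Glue `g` and `g'` to a morphism out of the triangle and restrict it to the long edge from 0 to
2. -/
lemma edge_trans (hF : Cocontinuous.{u} F) {g g' : F.obj edge ⟶ d}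
    (h : F.map (endpoint true) ≫ g = F.map (endpoint false) ≫ g') :
    ∃ k : F.obj edge ⟶ d, F.map (endpoint false) ≫ k = F.map (endpoint false) ≫ g ∧
      F.map (endpoint true) ≫ k = F.map (endpoint true) ≫ g' := by
  let t : composable.Realization F d :=
    { vert := fun x => ![F.map (endpoint false) ≫ g, F.map (endpoint true) ≫ g,
        F.map (endpoint true) ≫ g'] x.down
      edge := fun e => cond e.down g' g
      comm := by
        rintro ⟨_ | _⟩ (_ | _)
        · rfl
        · rfl
        · exact h.symm
        · rfl }
  obtain ⟨k, ⟨hk, -⟩, -⟩ := presents_composable.isUniversal_mapRealization F hF d t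
  have h₀₂ : (⟨0⟩ : ULift.{u} (Fin 3)) ≤ ⟨2⟩ := (by decide : (0 : Fin 3) ≤ 2)
  refine ⟨F.map (ObjectProperty.homMk (edgeTo triangle.obj
    (fun b => (⟨cond b 2 0⟩ : ULift (Fin 3))) h₀₂)) ≫ k, ?_, ?_⟩
  · rw [← Category.assoc, ← F.map_comp]
    exact hk ⟨0⟩
  · rw [← Category.assoc, ← F.map_comp]
    exact hk ⟨2⟩

/-- The poset of the points of an object `d`, ordered by the existence of a connecting edge. -/
@[reducible]
def pointOrder (hF : Cocontinuous.{u} F) (d : D) : PartialOrder (F.obj point ⟶ d) where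
  le p p' := ∃ g : F.obj edge ⟶ d, F.map (endpoint false) ≫ g = p ∧ F.map (endpoint true) ≫ g = p'
  le_refl p := by
    let r : edge.{u} ⟶ point := ObjectProperty.homMk (PartOrd.ofHom (OrderHom.const _ PUnit.unit))
    have h : ∀ b, endpoint b ≫ r = 𝟙 point := fun b => rfl
    exact ⟨F.map r ≫ p, by rw [← Category.assoc, ← F.map_comp, h, F.map_id, Category.id_comp],
      by rw [← Category.assoc, ← F.map_comp, h, F.map_id, Category.id_comp]⟩
  le_trans := by
    rintro _ _ _ ⟨g, rfl, rfl⟩ ⟨g', h, rfl⟩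
    exact edge_trans hF h.symm
  le_antisymm := by
    rintro _ _ ⟨g, rfl, rfl⟩ ⟨g', h, h'⟩
    exact edge_antisymm hF (g := g) (g' := g') (by rintro (_ | _); exacts [h'.symm, h.symm])

end Simplex

namespace PosetGraph.Realization

open Simplex

variable {D : Type w} [Category.{v} D] {F : Simplex.{u} ⥤ D}

lemma exists_isUniversal (hD : Cocomplete.{u} D) (Γ : PosetGraph.{u}) (F : Simplex.{u} ⥤ D) :
    ∃ (d : D) (t : Γ.Realization F d), t.IsUniversal :=
  ⟨_, _, isUniversal_ofCocone (colimit.isColimit (Γ.diagram ⋙ F))⟩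

lemma IsUniversal.hom_ext_vert (hF : Cocontinuous.{u} F) {Γ : PosetGraph.{u}} {d d' : D}
    {t : Γ.Realization F d} (ht : t.IsUniversal) {g g' : d ⟶ d'}
    (h : ∀ x, t.vert x ≫ g = t.vert x ≫ g') : g = g' :=
  ht.hom_ext h fun e => edge_hom_ext hF fun b => by
    rw [← Category.assoc, ← Category.assoc, t.comm, h]

variable {d d' : D} {P : PartOrd.{u}}

/-- Every morphism out of a realization of a poset is monotone on points. -/
def pointMap (hF : Cocontinuous.{u} F) (t : (ofPoset P).Realization F d) (g : d ⟶ d') :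
    letI := pointOrder hF d'
    P →o (F.obj point ⟶ d') :=
  letI := pointOrder hF d'
  { toFun := fun x => t.vert x ≫ g
    monotone' := fun x y hxy => by
      let e : (ofPoset P).E := ⟨fun b => cond b y x, hxy⟩
      refine ⟨t.edge e ≫ g, ?_, ?_⟩
      · rw [← Category.assoc, t.comm]; rfl
      · rw [← Category.assoc, t.comm]; rfl }

/-- Monotonicity of `f` supplies the edges of a realization in `d'`. With `pointMap` and
`hom_ext_vert` this is the adjunction bijection. -/
lemma IsUniversal.exists_hom (hF : Cocontinuous.{u} F) {t : (ofPoset P).Realization F d}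
    (ht : t.IsUniversal) (d' : D) :
    letI := pointOrder hF d'
    ∀ f : P →o (F.obj point ⟶ d'), ∃ g : d ⟶ d', ∀ x, t.vert x ≫ g = f x := by
  let := pointOrder hF d'
  intro f
  choose k hk hk' using fun e : (ofPoset P).E => f.monotone e.2
  obtain ⟨g, hg, -⟩ := ht d'
    { vert := f
      edge := k
      comm := by
        rintro e (_ | _)
        exacts [hk e, hk' e] }
  exact ⟨g, hg.1⟩

end PosetGraph.Realization

theorem exists_cocontinuous_extension {D : Type w} [Category.{v} D] (hD : Cocomplete.{u} D)
    {F : Simplex.{u} ⥤ D} (hF : Cocontinuous.{u} F) :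
    ∃ G : PartOrd.{u} ⥤ D, Cocontinuous.{u} G ∧ Nonempty (simplexInclusion.{u} ⋙ G ≅ F) := by
  open Simplex PosetGraph Realization in
  choose X t ht using fun P : PartOrd.{u} => exists_isUniversal hD (ofPoset P) F
  have ext {P : PartOrd.{u}} {d : D} {g g' : X P ⟶ d}
      (h : ∀ x : P, (t P).vert x ≫ g = (t P).vert x ≫ g') : g = g' := (ht P).hom_ext_vert hF h
  have hmap : ∀ (P Q : PartOrd.{u}) (φ : P ⟶ Q),
      ∃ g : X P ⟶ X Q, ∀ x : P, (t P).vert x ≫ g = (t Q).vert (φ.hom x) := by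
    intro P Q φ
    let := pointOrder hF (X Q)
    obtain ⟨g, hg⟩ := (ht P).exists_hom hF _ (((t Q).pointMap hF (𝟙 _)).comp φ.hom)
    exact ⟨g, fun x => (hg x).trans (Category.comp_id _)⟩
  choose m hm using hmap
  let G : PartOrd.{u} ⥤ D :=
    { obj := X
      map := fun {P Q} φ => m P Q φ
      map_id := fun P => ext fun x => by rw [hm, Category.comp_id]; rfl
      map_comp := fun {P Q R} φ ψ => ext fun x => by
        rw [hm, ← Category.assoc, hm, hm]; rfl }
  refine ⟨G, ⟨⟨fun {K} => ⟨fun {c} hc => ?_⟩⟩⟩, ⟨?_⟩⟩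
  · have hdesc : ∀ s : Cocone (K ⋙ G),
        ∃ g : X c.pt ⟶ s.pt, ∀ j, G.map (c.ι.app j) ≫ g = s.ι.app j := by
      intro s
      let := pointOrder hF s.pt
      -- Transpose the cocone to the poset of points of `s.pt`, descend there, and transpose back.
      obtain ⟨f, hf⟩ := PartOrd.exists_desc_of_isColimit hc
        (fun j => (t (K.obj j)).pointMap hF (s.ι.app j)) (fun i j φ x => by
          change (t (K.obj j)).vert _ ≫ s.ι.app j = (t (K.obj i)).vert x ≫ s.ι.app i
          rw [← s.w φ]
          change _ = (t (K.obj i)).vert x ≫ m _ _ (K.map φ) ≫ _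
          rw [← Category.assoc, hm])
      obtain ⟨g, hg⟩ := (ht c.pt).exists_hom hF _ f
      refine ⟨g, fun j => ext fun x => ?_⟩
      change (t (K.obj j)).vert x ≫ m _ _ _ ≫ g = _
      rw [← Category.assoc, hm]
      exact (hg _).trans (hf j x)
    choose g hg using hdesc
    refine ⟨{ desc := g, fac := hg, uniq := fun s g' hg' => ext fun x => ?_ }⟩
    let := pointOrder hF s.pt
    have h : (t c.pt).pointMap hF g' = (t c.pt).pointMap hF (g s) :=
      PartOrd.hom_ext_of_isColimit hc fun j x => by
        have hx : (t (K.obj j)).vert x ≫ m _ _ (c.ι.app j) =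
          (t c.pt).vert ((c.ι.app j).hom x) := hm _ _ (c.ι.app j) x
        have hj : m _ _ (c.ι.app j) ≫ g' = m _ _ (c.ι.app j) ≫ g s :=
          (hg' j).trans (hg s j).symm
        change (t c.pt).vert ((c.ι.app j).hom x) ≫ g' = (t c.pt).vert ((c.ι.app j).hom x) ≫ g s
        rw [← hx, Category.assoc, Category.assoc]
        exact congrArg _ hj
    exact congr($h x)
  -- Both `F.obj S` and `X S.obj` carry universal realizations of the same graph; `a` and `b`
  -- compare them.
  · have hS : ∀ S : Simplex.{u}, ((presents_ofPoset S.obj).mapRealization F).IsUniversal :=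
      fun S => (presents_ofPoset S.obj).isUniversal_mapRealization F hF
    have hS' {S : Simplex.{u}} {d : D} {g g' : F.obj S ⟶ d}
      (h : ∀ x : S.obj, F.map (ObjectProperty.homMk (pointTo S.obj x)) ≫ g =
        F.map (ObjectProperty.homMk (pointTo S.obj x)) ≫ g') : g = g' := (hS S).hom_ext_vert hF h
    choose a ha _ using fun S : Simplex.{u} =>
      ht S.obj _ ((presents_ofPoset S.obj).mapRealization F)
    choose b hb _ using fun S : Simplex.{u} => hS S _ (t S.obj)
    have ha' : ∀ (S : Simplex.{u}) (x : S.obj), (t S.obj).vert x ≫ a S =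
      F.map (ObjectProperty.homMk (pointTo S.obj x)) := fun S => (ha S).1
    have hb' : ∀ (S : Simplex.{u}) (x : S.obj),
      F.map (ObjectProperty.homMk (pointTo S.obj x)) ≫ b S = (t S.obj).vert x := fun S => (hb S).1
    refine NatIso.ofComponents (fun S => ⟨a S, b S, ext fun x => ?_, hS' fun x => ?_⟩)
      fun {S S'} φ => ext fun x => ?_
    · change (t S.obj).vert x ≫ a S ≫ b S = (t S.obj).vert x ≫ 𝟙 _
      rw [← Category.assoc, ha', hb', Category.comp_id]
    · rw [← Category.assoc, hb', ha', Category.comp_id]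
    · change (t S.obj).vert x ≫ m _ _ φ.hom ≫ a S' = (t S.obj).vert x ≫ a S ≫ F.map φ
      rw [← Category.assoc, hm, ha', ← Category.assoc, ha', ← F.map_comp]
      rfl

theorem mainTheorem1 :
    IsFreeConservativeCocompletion.{u, v, w} simplexInclusion.{u} where
  cocomplete := PartOrd.cocomplete
  full := inferInstance
  faithful := inferInstance
  cocontinuous := Simplex.cocontinuous_inclusion
  exists_extension _ _ hD _ hF := exists_cocontinuous_extension hD hF
  unique_extension _ _ _ _ _ _ _ hG hG' α α' := existsUnique_iso hG hG' α α'
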